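/- Let $\mathbb N=\{1,2,3,\dots\}$. For a set $X$ let $\mathcal P_f(X)$ be the collection of nonempty finite subsets of $X$, let ${}^{\mathbb N}\mathbb N$ be the set of all functions $\mathbb N\to\mathbb N$, and for $F,G\in\mathcal P_f(\mathbb N)$ write $F<G$ if $\max F<\min G$. A set $B\subseteq\mathbb N$ is a $J$-set if for every $F\in\mathcal P_f({}^{\mathbb N}\mathbb N)$ there are $a\in\mathbb N$ and $\beta\in\mathcal P_f(\mathbb N)$ such that $a+\sum_{t\in\beta}f(t)\in B$ for all $f\in F$. Let $\mathcal J$ be the set of ultrafilters on $\mathbb N$ all of whose members are $J$-sets. For ultrafilters $p,q$ on $\mathbb N$, the ultrafilter $p+q$ is given by: $B\in p+q$ if and only if $\{x:\{y:x+y\in B\}\in q\}\in p$. The tensor product of ultrafilters $p_1,\dots,p_m$ on $\mathbb N$ is the ultrafilter on $\mathbb N^m$ defined recursively by $\bigotimes_{i=1}^1p_i=p_1$ and, for $B\subseteq\mathbb N^{k+1}$, $B\in\bigotimes_{i=1}^{k+1}p_i$ if and only if $\{(x_1,\dots,x_k):\{x_{k+1}:(x_1,\dots,x_{k+1})\in B\}\in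 p_{k+1}\}\in\bigotimes_{i=1}^kp_i$. Let $m\in\mathbb N$ and $A\subseteq\mathbb N^m$. The following two statements are equivalent. (1) There exist functions $\alpha_1,\dots,\alpha_m:\mathcal P_f({}^{\mathbb N}\mathbb N)\to\mathbb N$ and $H_1,\dots,H_m:\mathcal P_f({}^{\mathbb N}\mathbb N)\to\mathcal P_f(\mathbb N)$ such that (a) if $F,G\in\mathcal P_f({}^{\mathbb N}\mathbb N)$ and $F\subsetneq G$, then $\max H_j(F)<\min H_j(G)$ for every $j\in\{1,\dots,m\}$; and (b) for every infinite chain $G_1\subsetneq G_2\subsetneq\cdots$ in $\mathcal P_f({}^{\mathbb N}\mathbb N)$, all $\beta_1<\beta_2<\dots<\beta_m$ in $\mathcal P_f(\mathbb N)$, and all choices of $f_i\in G_i$ $(i\in\mathbb N)$, $$\left(\sum_{i\in\beta_1}\Bigl(\alpha_1(G_i)+\sum_{t\in H_1(G_i)}f_i(t)\Bigr),\ \dots,\ \sum_{i\in\beta_m}\Bigl(\alpha_m(G_i)+\sum_{t\in H_m(G_i)}f_i(t)\Bigr)\right)\in A.$$ (2) There exist $p_1,\dots,p_m\in\mathcal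 J$ with $p_i+p_i=p_i$ for each $i$ such that $A\in\bigotimes_{i=1}^mp_i$. -/

import Mathlib

attribute [local instance] Ultrafilter.add

/-- `Pf X` is the collection of all nonempty finite subsets of `X`. -/
abbrev Pf (X : Type*) := {s : Finset X // s.Nonempty}

/-- For nonempty finite sets `F`, `G` of positive integers, `F < G` in the sense that
`max F < min G`. -/
def Precedes (F G : Pf ℕ+) : Prop :=
  F.1.max' F.2 < G.1.min' G.2

/-- The sum `∑ t ∈ β, g t` of positive integers over a nonempty finite set `β`, as a positive
integer (`ℕ+` has no zero, so the sum is computed in `ℕ`). -/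
def posSum {ι : Type*} (β : Pf ι) (g : ι → ℕ+) : ℕ+ :=
  ⟨∑ t ∈ β.1, (g t : ℕ), Finset.sum_pos (fun t _ => (g t).pos) β.2⟩

/-- `A` is a `J`-set: for every nonempty finite set `F` of sequences of positive integers there
are `a` and a nonempty finite `β` with `a + ∑ t ∈ β, f t ∈ A` for all `f ∈ F`. -/
def IsJSet (A : Set ℕ+) : Prop :=
  ∀ F : Pf (ℕ+ → ℕ+), ∃ (a : ℕ+) (β : Pf ℕ+), ∀ f ∈ F.1, a + posSum β f ∈ A

/-- The set of all ultrafilters on the positive integers all of whose members are `J`-sets. -/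
def JUltrafilters : Set (Ultrafilter ℕ+) :=
  {p | ∀ A ∈ p, IsJSet A}

/-- The tensor product `p₁ ⊗ ⋯ ⊗ p_k` of ultrafilters on `S`, an ultrafilter on `S ^ k`.
See `mem_tensor_one` and `mem_tensor_succ` for the description of its members. The empty tensor
product is the only ultrafilter on the one-point space. -/
def tensor {S : Type*} : (k : ℕ) → (Fin k → Ultrafilter S) → Ultrafilter (Fin k → S)
  | 0, _ => pure Fin.elim0
  | k + 1, p =>
      (tensor k (fun i => p i.castSucc)).bind fun x =>
        (p (Fin.last k)).map fun y => Fin.snoc (α := fun _ => S) x y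

theorem mem_tensor_succ {S : Type*} (k : ℕ) (p : Fin (k + 1) → Ultrafilter S)
    (A : Set (Fin (k + 1) → S)) :
    A ∈ tensor (k + 1) p ↔
      {x : Fin k → S | {y : S | Fin.snoc (α := fun _ => S) x y ∈ A} ∈ p (Fin.last k)} ∈
        tensor k (fun i => p i.castSucc) :=
  Iff.rfl

theorem mem_tensor_one {S : Type*} (p : Fin 1 → Ultrafilter S) (A : Set (Fin 1 → S)) :
    A ∈ tensor 1 p ↔ {y : S | (fun _ => y) ∈ A} ∈ p 0 := by
  rw [mem_tensor_succ]
  have h : ∀ y : S, Fin.snoc (α := fun _ => S) Fin.elim0 y = fun _ : Fin 1 => y := by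
    intro y
    funext i
    fin_cases i
    rfl
  simp only [← h]
  exact Iff.rfl

/-! From functions to ultrafilters: for each coordinate, the sums along finite chains strictly above
`F` form a directed family of J-sets as `F` varies, and a sum can be continued by any sum far enough
up. Partition regularity of J-sets (`IsJSet.of_union`, via Hales–Jewett) and the idempotent theorem
for compact semigroups give an idempotent in `JUltrafilters` containing the family. The tensor then
contains `A`, because finite initial parts of chains can be prolonged by large sets of sums
(`mem_tensor_of_chainSum`).

From ultrafilters to functions: membership in the tensor is a tree with large successor sets
(`mem_tensor_iff_exists`). Recursion on finite sets under strict inclusion picks values that handle,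
at once, every node and partial sum below a bound `b F`. This bound dominates all that proper
subsets of `F` can produce (`exists_step`, `exists_bound`). -/

theorem coe_posSum {ι : Type*} (β : Pf ι) (g : ι → ℕ+) :
    (posSum β g : ℕ) = ∑ t ∈ β.1, (g t : ℕ) := rfl

theorem posSum_singleton {ι : Type*} (a : ι) (h : ({a} : Finset ι).Nonempty) (g : ι → ℕ+) :
    posSum ⟨{a}, h⟩ g = g a := by
  apply PNat.eq
  simp [coe_posSum]

theorem posSum_insert {ι : Type*} [DecidableEq ι] {a : ι} {s : Finset ι} (ha : a ∉ s)
    (h : (insert a s).Nonempty) (hs : s.Nonempty) (g : ι → ℕ+) :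
    posSum ⟨insert a s, h⟩ g = g a + posSum ⟨s, hs⟩ g := by
  apply PNat.eq
  simp [coe_posSum, Finset.sum_insert ha]

theorem posSum_congr {ι : Type*} {β : Pf ι} {g g' : ι → ℕ+} (h : ∀ t ∈ β.1, g t = g' t) :
    posSum β g = posSum β g' := by
  apply PNat.eq
  simp only [coe_posSum]
  exact Finset.sum_congr rfl fun t ht => by rw [h t ht]

theorem Precedes.lt {F G : Pf ℕ+} (h : Precedes F G) {i j : ℕ+} (hi : i ∈ F.1) (hj : j ∈ G.1) :
    i < j :=
  (Finset.le_max' _ _ hi).trans_lt (h.trans_le (Finset.min'_le _ _ hj))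

theorem precedes_of_forall_lt {F G : Pf ℕ+} (h : ∀ i ∈ F.1, ∀ j ∈ G.1, i < j) : Precedes F G :=
  h _ (Finset.max'_mem _ _) _ (Finset.min'_mem _ _)

/-! ### J-sets and partition regularity -/

theorem IsJSet.mono {A B : Set ℕ+} (hA : IsJSet A) (h : A ⊆ B) : IsJSet B := by
  intro F
  obtain ⟨a, β, hβ⟩ := hA F
  exact ⟨a, β, fun f hf => h (hβ f hf)⟩

/-- In the definition of a `J`-set the index set can be chosen above a given bound. -/
theorem IsJSet.exists_gt {A : Set ℕ+} (hA : IsJSet A) (F : Pf (ℕ+ → ℕ+)) (n : ℕ+) :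
    ∃ (a : ℕ+) (β : Pf ℕ+), (∀ t ∈ β.1, n < t) ∧ ∀ f ∈ F.1, a + posSum β f ∈ A := by
  classical
  obtain ⟨a, β, hβ⟩ := hA ⟨F.1.image fun f t => f (t + n), F.2.image _⟩
  refine ⟨a, ⟨β.1.image (· + n), β.2.image _⟩, ?_, fun f hf => ?_⟩
  · intro t ht
    obtain ⟨s, -, rfl⟩ := Finset.mem_image.1 ht
    exact PNat.lt_add_left n s
  · convert hβ _ (Finset.mem_image_of_mem _ hf) using 2
    apply PNat.eq
    simp only [coe_posSum]
    exact Finset.sum_image fun x _ y _ h => add_right_cancel h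

/-- `J`-sets are partition regular. -/
theorem IsJSet.of_union {A B : Set ℕ+} (h : IsJSet (A ∪ B)) : IsJSet A ∨ IsJSet B := by
  classical
  by_contra! hcon
  obtain ⟨hA, hB⟩ := hcon
  obtain ⟨F₁, hF₁⟩ := not_forall.1 hA
  obtain ⟨F₂, hF₂⟩ := not_forall.1 hB
  let F := F₁.1 ∪ F₂.1
  -- Hales–Jewett with alphabet `F`; a word will be coloured by whether its sum lies in `A`.
  obtain ⟨ι, _, hι⟩ := Combinatorics.Line.exists_mono_in_high_dimension {f // f ∈ F} Prop
  have hne : Nonempty ι := by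
    obtain ⟨l, -⟩ := hι fun _ => True
    exact ⟨l.proper.choose⟩
  obtain ⟨φ⟩ : Nonempty (ℕ+ × ι ↪ ℕ+) := by
    obtain ⟨e⟩ := nonempty_embedding_nat (ℕ+ × ι)
    exact ⟨e.trans Equiv.pnatEquivNat.symm.toEmbedding⟩
  let g : (ι → {f // f ∈ F}) → ℕ+ → ℕ+ := fun w t =>
    posSum ⟨Finset.univ, Finset.univ_nonempty⟩ fun i => (w i).1 (φ (t, i))
  obtain ⟨f₀, hf₀⟩ := F₁.2
  let f₀' : {f // f ∈ F} := ⟨f₀, Finset.mem_union_left _ hf₀⟩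
  obtain ⟨a, β, hβ⟩ := h ⟨Finset.univ.image g, ⟨g fun _ => f₀', by simp⟩⟩
  have hβ' : ∀ w, a + posSum β (g w) ∈ A ∪ B := fun w => hβ _ (by simp)
  obtain ⟨l, c, hl⟩ := hι fun w => a + posSum β (g w) ∈ A
  let V : Finset ι := Finset.univ.filter fun i => l.idxFun i = none
  have hV : V.Nonempty := by
    obtain ⟨i, hi⟩ := l.proper
    exact ⟨i, by simp [V, hi]⟩
  let γ : Pf ℕ+ := ⟨(β.1 ×ˢ V).map φ, (β.2.product hV).map⟩
  -- The fixed coordinates of the line do not depend on the letter, so `b` absorbs them and only the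
  -- active ones, collected in `γ`, see `f`.
  let b : ℕ+ := ⟨a + ∑ t ∈ β.1, ∑ i ∈ Vᶜ, ((l f₀' i).1 (φ (t, i)) : ℕ), by positivity⟩
  have key : ∀ f : {f // f ∈ F}, a + posSum β (g (l f)) = b + posSum γ f.1 := by
    intro f
    apply PNat.eq
    change (a : ℕ) + ∑ t ∈ β.1, ∑ i : ι, ((l f i).1 (φ (t, i)) : ℕ) =
      (a + ∑ t ∈ β.1, ∑ i ∈ Vᶜ, ((l f₀' i).1 (φ (t, i)) : ℕ)) +
        ∑ t ∈ (β.1 ×ˢ V).map φ, (f.1 t : ℕ)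
    rw [Finset.sum_map, Finset.sum_product, add_assoc, ← Finset.sum_add_distrib]
    congr 1
    refine Finset.sum_congr rfl fun t _ => ?_
    rw [← Finset.sum_compl_add_sum V]
    congr 1
    · refine Finset.sum_congr rfl fun i hi => ?_
      have hi' : l.idxFun i ≠ none := by simpa [V] using hi
      obtain ⟨y, hy⟩ := Option.ne_none_iff_exists'.1 hi'
      simp [hy]
    · refine Finset.sum_congr rfl fun i hi => ?_
      have hi' : l.idxFun i = none := by simpa [V] using hi
      rw [Combinatorics.Line.apply_none _ _ _ hi']
  by_cases hc : c
  · refine hF₁ ⟨b, γ, fun f hf => ?_⟩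
    rw [← key ⟨f, Finset.mem_union_left _ hf⟩]
    exact (hl _).mpr hc
  · refine hF₂ ⟨b, γ, fun f hf => ?_⟩
    rw [← key ⟨f, Finset.mem_union_right _ hf⟩]
    exact (hβ' _).resolve_left fun h' => hc ((hl _).mp h')

theorem not_isJSet_empty : ¬ IsJSet ∅ := by
  intro h
  obtain ⟨a, β, hβ⟩ := h ⟨{fun _ => 1}, by simp⟩
  exact hβ _ (Finset.mem_singleton_self _)

/-- The filter of all sets whose complement is not a `J`-set. -/
def coJSet : Filter ℕ+ where
  sets := {A | ¬ IsJSet Aᶜ}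
  univ_sets := by simpa using not_isJSet_empty
  sets_of_superset hA h hB := hA (hB.mono (Set.compl_subset_compl.2 h))
  inter_sets hA hB h := by
    rw [Set.compl_inter] at h
    exact h.of_union.elim hA hB

/-! ### Idempotent ultrafilters of J-sets -/

theorem exists_mem_JUltrafilters {ι : Type*} [Nonempty ι] (T : ι → Set ℕ+)
    (hT : Directed (· ≥ ·) T) (hJ : ∀ i, IsJSet (T i)) :
    ∃ p ∈ JUltrafilters, ∀ i, T i ∈ p := by
  have hne : (⨅ i, coJSet ⊓ Filter.principal (T i)).NeBot := by
    apply Filter.iInf_neBot_of_directed'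
    · intro i j
      obtain ⟨k, hk₁, hk₂⟩ := hT i j
      exact ⟨k, inf_le_inf_left _ (Filter.principal_mono.2 hk₁),
        inf_le_inf_left _ (Filter.principal_mono.2 hk₂)⟩
    · intro i
      rw [Filter.inf_principal_neBot_iff]
      intro U hU
      by_contra hcon
      rw [Set.not_nonempty_iff_eq_empty, ← Set.disjoint_iff_inter_eq_empty] at hcon
      exact hU ((hJ i).mono hcon.subset_compl_left)
  refine ⟨Ultrafilter.of (⨅ i, coJSet ⊓ Filter.principal (T i)), fun A hA => ?_, fun i => ?_⟩
  · by_contra hcon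
    have h₁ : Aᶜ ∈ coJSet := by simpa [coJSet, ← Filter.mem_sets] using hcon
    obtain ⟨i⟩ := ‹Nonempty ι›
    have h₂ := (Ultrafilter.of_le _).trans ((iInf_le (fun i => coJSet ⊓ Filter.principal (T i)) i).trans
      inf_le_left) h₁
    exact Ultrafilter.compl_mem_iff_notMem.1 h₂ hA
  · exact (Ultrafilter.of_le _).trans ((iInf_le (fun i => coJSet ⊓ Filter.principal (T i)) i).trans
      inf_le_right)
      (Filter.mem_principal_self _)

theorem mem_add_iff (p q : Ultrafilter ℕ+) (B : Set ℕ+) :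
    B ∈ p + q ↔ {x | {y | x + y ∈ B} ∈ q} ∈ p := Iff.rfl

theorem add_mem_JUltrafilters (p : Ultrafilter ℕ+) {q : Ultrafilter ℕ+}
    (hq : q ∈ JUltrafilters) : p + q ∈ JUltrafilters := by
  intro A hA
  obtain ⟨x, hx⟩ := p.nonempty_of_mem ((mem_add_iff _ _ _).1 hA)
  intro F
  obtain ⟨a, β, hβ⟩ := hq _ hx F
  exact ⟨x + a, β, fun f hf => by rw [add_assoc]; exact hβ f hf⟩

theorem isClosed_JUltrafilters : IsClosed JUltrafilters := by
  have : JUltrafilters = ⋂ (A : Set ℕ+) (_ : ¬ IsJSet A), {p | Aᶜ ∈ p} := by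
    ext p
    simp only [JUltrafilters, Set.mem_ofPred_eq, Set.mem_iInter, Ultrafilter.compl_mem_iff_notMem]
    exact ⟨fun h A hA hp => hA (h A hp), fun h A hA => by_contra fun hn => h A hn hA⟩
  rw [this]
  exact isClosed_iInter fun A => isClosed_iInter fun _ => ultrafilter_isClosed_basic _

/-- By `hadd`, the members of `JUltrafilters` containing every `T i` form a subsemigroup; it is
closed and nonempty, so it has an idempotent. -/
theorem exists_idempotent_mem_JUltrafilters {ι : Type*} [Nonempty ι] (T : ι → Set ℕ+)
    (hT : Directed (· ≥ ·) T) (hJ : ∀ i, IsJSet (T i))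
    (hadd : ∀ i, ∀ x ∈ T i, ∃ j, ∀ y ∈ T j, x + y ∈ T i) :
    ∃ p ∈ JUltrafilters, p + p = p ∧ ∀ i, T i ∈ p := by
  let S : Set (Ultrafilter ℕ+) := JUltrafilters ∩ ⋂ i, {p | T i ∈ p}
  have hS : IsClosed S :=
    isClosed_JUltrafilters.inter (isClosed_iInter fun i => ultrafilter_isClosed_basic _)
  have hne : S.Nonempty := by
    obtain ⟨p, hp, hTp⟩ := exists_mem_JUltrafilters T hT hJ
    exact ⟨p, hp, Set.mem_iInter.2 hTp⟩
  obtain ⟨p, ⟨hp, hTp⟩, hpp⟩ := @exists_idempotent_in_compact_add_subsemigroup (Ultrafilter ℕ+)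
    Ultrafilter.addSemigroup _ _ Ultrafilter.continuous_add_left S hne hS.isCompact (by
      intro p hp q hq
      refine ⟨add_mem_JUltrafilters p hq.1, Set.mem_iInter.2 fun i => ?_⟩
      refine Filter.mem_of_superset (Set.mem_iInter.1 hp.2 i) fun x hx => ?_
      obtain ⟨j, hj⟩ := hadd i x hx
      exact Filter.mem_of_superset (Set.mem_iInter.1 hq.2 j) hj)
  exact ⟨p, hp, hpp, Set.mem_iInter.1 hTp⟩

/-- The points of `B` at which the translate of `B` is still `p`-large. -/
def starSet (p : Ultrafilter ℕ+) (B : Set ℕ+) : Set ℕ+ :=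
  {y | y ∈ B ∧ {z | y + z ∈ B} ∈ p}

theorem starSet_mem {p : Ultrafilter ℕ+} (hp : p + p = p) {B : Set ℕ+} (hB : B ∈ p) :
    starSet p B ∈ p := by
  refine Filter.inter_mem hB ?_
  rw [← hp] at hB
  exact hB

theorem translate_starSet_mem {p : Ultrafilter ℕ+} (hp : p + p = p) {B : Set ℕ+} {y : ℕ+}
    (hy : y ∈ starSet p B) : {z | y + z ∈ starSet p B} ∈ p := by
  refine Filter.mem_of_superset (starSet_mem hp hy.2) fun z hz => ⟨hz.1, ?_⟩
  simpa only [Set.mem_ofPred_eq, add_assoc] using hz.2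

/-! ### Tensor products as trees; from ultrafilters to functions -/

theorem mem_tensor_iff_exists {S : Type*} (m : ℕ) (p : Fin m → Ultrafilter S)
    (A : Set (Fin m → S)) :
    A ∈ tensor m p ↔ ∃ C : ∀ k, Set (Fin k → S), Fin.elim0 ∈ C 0 ∧
      (∀ k : Fin m, ∀ x ∈ C k, {y | Fin.snoc (α := fun _ => S) x y ∈ C (k + 1)} ∈ p k) ∧
      C m ⊆ A := by
  induction m with
  | zero =>
    constructor
    · intro h
      refine ⟨fun k => {x | ∀ h : k = 0, (fun i : Fin 0 => x (i.cast h.symm)) ∈ A}, ?_,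
        fun k => k.elim0, fun x hx => hx rfl⟩
      intro _
      exact h
    · rintro ⟨C, h0, -, hA⟩
      exact hA h0
  | succ m ih =>
    rw [mem_tensor_succ, ih]
    constructor
    · rintro ⟨C, h0, hs, hA⟩
      refine ⟨Function.update C (m + 1) A, by simpa using h0, fun k => ?_, by simp⟩
      refine Fin.lastCases ?_ (fun k => ?_) k
      · have e₁ : Function.update C (m + 1) A m = C m := Function.update_of_ne (by simp) _ _
        have e₂ : Function.update C (m + 1) A (m + 1) = A := Function.update_self _ _ _
        change ∀ x ∈ Function.update C (m + 1) A m,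
          {y | Fin.snoc (α := fun _ => S) x y ∈ Function.update C (m + 1) A (m + 1)} ∈ _
        rw [e₁, e₂]
        exact fun x hx => hA hx
      · have e₁ : Function.update C (m + 1) A k = C k := Function.update_of_ne (by omega) _ _
        have e₂ : Function.update C (m + 1) A (k + 1) = C (k + 1) :=
          Function.update_of_ne (by omega) _ _
        change ∀ x ∈ Function.update C (m + 1) A k,
          {y | Fin.snoc (α := fun _ => S) x y ∈ Function.update C (m + 1) A (k + 1)} ∈ _
        rw [e₁, e₂]
        exact hs k
    · rintro ⟨C, h0, hs, hA⟩
      refine ⟨C, h0, fun k => hs k.castSucc, fun x hx => ?_⟩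
      exact Filter.mem_of_superset (hs (Fin.last m) x hx) fun y hy => hA hy

/-- Well-founded recursion: `b F` is the maximum of the finitely many `c (b G) G`, with `1` added to
cover `F = ∅`. -/
theorem exists_bound {X : Type*} (c : ℕ+ → Finset X → ℕ+) :
    ∃ b : Finset X → ℕ+, ∀ G F : Finset X, G ⊂ F → c (b G) G ≤ b F := by
  classical
  let b : Finset X → ℕ+ := Finset.strongInduction fun s ih =>
    (insert 1 (s.ssubsets.attach.image fun t => c (ih t.1 (Finset.mem_ssubsets.1 t.2)) t.1)).max'
      (Finset.insert_nonempty _ _)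
  refine ⟨b, fun G F h => ?_⟩
  have hF : b F = _ := Finset.strongInduction_eq _ F
  rw [hF]
  apply Finset.le_max'
  apply Finset.mem_insert_of_mem
  exact Finset.mem_image.2 ⟨⟨G, Finset.mem_ssubsets.2 h⟩, Finset.mem_attach _ _, rfl⟩

/-- Only finitely many `x` and `y` lie below `b`, so all the requirements intersect to one member of
`p k`, which is a J-set. Hence `a` and `H` depend on neither `x` nor `y`. -/
theorem exists_step {m : ℕ} {p : Fin m → Ultrafilter ℕ+}
    (hp : ∀ j, p j ∈ JUltrafilters ∧ p j + p j = p j) (C : ∀ k, Set (Fin k → ℕ+))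
    (hC : ∀ k : Fin m, ∀ x ∈ C k, {y | Fin.snoc (α := fun _ => ℕ+) x y ∈ C (k + 1)} ∈ p k)
    (b : ℕ+) (F : Pf (ℕ+ → ℕ+)) (k : Fin m) :
    ∃ (a : ℕ+) (H : Pf ℕ+), (∀ t ∈ H.1, b < t) ∧ ∀ f ∈ F.1, ∀ x ∈ C k, (∀ i, x i ≤ b) →
      a + posSum H f ∈ starSet (p k) {y | Fin.snoc (α := fun _ => ℕ+) x y ∈ C (k + 1)} ∧
      ∀ y ∈ starSet (p k) {y | Fin.snoc (α := fun _ => ℕ+) x y ∈ C (k + 1)}, y ≤ b →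
        y + (a + posSum H f) ∈
          starSet (p k) {y | Fin.snoc (α := fun _ => ℕ+) x y ∈ C (k + 1)} := by
  let B : (Fin k → ℕ+) → Set ℕ+ := fun x =>
    starSet (p k) {y | Fin.snoc (α := fun _ => ℕ+) x y ∈ C (k + 1)}
  let X : Set (Fin k → ℕ+) := C k ∩ Set.Iic fun _ => b
  have hX : X.Finite := (Set.finite_Iic _).inter_of_right _
  have hE : ⋂ x ∈ X, (B x ∩ ⋂ y ∈ B x ∩ Set.Iic b, {z | y + z ∈ B x}) ∈ p k := by
    refine (Filter.biInter_mem hX).2 fun x hx => Filter.inter_mem ?_ ?_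
    · exact starSet_mem (hp k).2 (hC k x hx.1)
    · exact (Filter.biInter_mem ((Set.finite_Iic b).inter_of_right _)).2 fun y hy =>
        translate_starSet_mem (hp k).2 hy.1
  obtain ⟨a, H, hH, h⟩ := ((hp k).1 _ hE).exists_gt F b
  refine ⟨a, H, hH, fun f hf x hx hxb => ?_⟩
  have h' := Set.mem_iInter₂.1 (h f hf) x ⟨hx, hxb⟩
  exact ⟨h'.1, fun y hy hyb => Set.mem_iInter₂.1 h'.2 y ⟨hy, hyb⟩⟩

theorem ssubset_of_lt_of_chain {X : Type*} {G : ℕ+ → Pf X}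
    (hG : ∀ i, (G i).1 ⊂ (G (i + 1)).1) {i j : ℕ+} (h : i < j) : (G i).1 ⊂ (G j).1 := by
  induction j using PNat.recOn with
  | one => exact absurd h (not_lt_one)
  | succ j ih =>
    rcases (PNat.lt_add_one_iff.1 h).eq_or_lt with rfl | h
    · exact hG i
    · exact (ih h).trans (hG j)

theorem exists_chain_functions {m : ℕ} {p : Fin m → Ultrafilter ℕ+}
    (hp : ∀ j, p j ∈ JUltrafilters ∧ p j + p j = p j) {A : Set (Fin m → ℕ+)}
    (hA : A ∈ tensor m p) :
    ∃ (α : Fin m → Pf (ℕ+ → ℕ+) → ℕ+) (H : Fin m → Pf (ℕ+ → ℕ+) → Pf ℕ+),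
      (∀ (j : Fin m) (F G : Pf (ℕ+ → ℕ+)), F.1 ⊂ G.1 → Precedes (H j F) (H j G)) ∧
      (∀ G : ℕ+ → Pf (ℕ+ → ℕ+), (∀ i, (G i).1 ⊂ (G (i + 1)).1) →
        ∀ β : Fin m → Pf ℕ+, (∀ j k : Fin m, j < k → Precedes (β j) (β k)) →
          ∀ f : ℕ+ → ℕ+ → ℕ+, (∀ i, f i ∈ (G i).1) →
            (fun j : Fin m =>
              posSum (β j) fun i => α j (G i) + posSum (H j (G i)) (f i)) ∈ A) := by
  classical
  obtain ⟨C, hC0, hC, hCA⟩ := (mem_tensor_iff_exists m p A).1 hA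
  choose a H hH hstep using exists_step hp C hC
  -- The summand `b` leaves room for an earlier partial sum, itself at most `b`.
  have hc : ∀ (b : ℕ+) (F : Pf (ℕ+ → ℕ+)), ∃ c : ℕ+, ∀ k : Fin m, (∀ t ∈ (H b F k).1, t ≤ c) ∧
      ∀ f ∈ F.1, b + (a b F k + posSum (H b F k) f) ≤ c := by
    intro b F
    obtain ⟨c, hc⟩ := (Finset.univ.biUnion fun k : Fin m => (H b F k).1 ∪
      F.1.image fun f => b + (a b F k + posSum (H b F k) f)).exists_le
    refine ⟨c, fun k => ⟨fun t ht => hc t ?_, fun f hf => hc _ ?_⟩⟩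
    · exact Finset.mem_biUnion.2 ⟨k, Finset.mem_univ _, Finset.mem_union_left _ ht⟩
    · exact Finset.mem_biUnion.2 ⟨k, Finset.mem_univ _, Finset.mem_union_right _
        (Finset.mem_image_of_mem _ hf)⟩
  choose c hc using hc
  obtain ⟨b, hb⟩ := exists_bound fun b (F : Finset (ℕ+ → ℕ+)) =>
    if h : F.Nonempty then c b ⟨F, h⟩ else 1
  replace hb : ∀ G F : Pf (ℕ+ → ℕ+), G.1 ⊂ F.1 → c (b G.1) G ≤ b F.1 := by
    intro G F h
    simpa [G.2] using hb G.1 F.1 h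
  refine ⟨fun k F => a (b F.1) F k, fun k F => H (b F.1) F k, fun k F G h => ?_, ?_⟩
  · exact precedes_of_forall_lt fun i hi j hj =>
      (((hc _ _ _).1 i hi).trans (hb F G h)).trans_lt (hH _ _ _ j hj)
  intro G hG β hβ f hf
  have hlt : ∀ i j, i < j → (G i).1 ⊂ (G j).1 := fun i j => ssubset_of_lt_of_chain hG
  let v : Fin m → ℕ+ → ℕ+ := fun k i =>
    a (b (G i).1) (G i) k + posSum (H (b (G i).1) (G i) k) (f i)
  have hbound : ∀ (k : Fin m) (s : Finset ℕ+) (hs : s.Nonempty) (n : ℕ+), (∀ i ∈ s, i < n) →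
      posSum ⟨s, hs⟩ (v k) ≤ b (G n).1 := by
    intro k s
    induction s using Finset.induction_on_max with
    | empty => intro hs; simp at hs
    | insert i s his ih =>
      intro hs n hn
      have h₁ : c (b (G i).1) (G i) ≤ b (G n).1 := hb _ _ (hlt i n (hn i (by simp)))
      have h₂ : b (G i).1 + v k i ≤ b (G n).1 := ((hc _ _ k).2 (f i) (hf i)).trans h₁
      rcases s.eq_empty_or_nonempty with rfl | hne
      · simp only [insert_empty_eq, posSum_singleton]
        exact (PNat.lt_add_left _ _).le.trans h₂
      · rw [posSum_insert (fun h => (his i h).false) _ hne, add_comm]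
        exact (add_le_add_left (ih hne i his) _).trans h₂
  have key : ∀ k (hk : k ≤ m), (fun j : Fin k => posSum (β (j.castLE hk)) (v (j.castLE hk))) ∈ C k := by
    intro k
    induction k with
    | zero =>
      intro _
      convert hC0
    | succ k ih =>
      intro hk
      have hx := ih (by omega)
      set x := fun j : Fin k => posSum (β (j.castLE (by omega))) (v (j.castLE (by omega))) with hxdef
      let k' : Fin m := ⟨k, hk⟩
      have hxb : ∀ i ∈ (β k').1, ∀ j, x j ≤ b (G i).1 := fun i hi j =>
        hbound _ _ (β (j.castLE (by omega))).2 i fun t ht => (hβ _ k' j.2).lt ht hi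
      -- Adding the largest index last keeps each partial sum below the bound used when the new term
      -- was chosen.
      have hstar : ∀ (s : Finset ℕ+) (hs : s.Nonempty), s ⊆ (β k').1 →
          posSum ⟨s, hs⟩ (v k') ∈
            starSet (p k') {y | Fin.snoc (α := fun _ => ℕ+) x y ∈ C (k + 1)} := by
        intro s
        induction s using Finset.induction_on_max with
        | empty => intro hs; simp at hs
        | insert i s his ih =>
          intro hs hsub
          obtain ⟨hi, hsub⟩ := Finset.insert_subset_iff.1 hsub
          have h := hstep (b (G i).1) (G i) k' (f i) (hf i) x hx (hxb i hi)
          rcases s.eq_empty_or_nonempty with rfl | hne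
          · simp only [insert_empty_eq, posSum_singleton]
            exact h.1
          · rw [posSum_insert (fun h => (his i h).false) _ hne, add_comm (v k' i)]
            exact h.2 _ (ih hne hsub) (hbound _ _ hne i his)
      have hmem : Fin.snoc (α := fun _ => ℕ+) x (posSum (β k') (v k')) ∈ C (k + 1) :=
        (hstar _ (β k').2 subset_rfl).1
      convert hmem using 1
      funext j
      refine Fin.lastCases ?_ (fun j => ?_) j
      · rw [Fin.snoc_last]
        rfl
      · simp [hxdef]
  exact hCA (key m le_rfl)

/-! ### Chain sums; from functions to ultrafilters -/

/-- Sums of values `v G f`, `f ∈ G`, along finite chains of sets `G` strictly containing `F`. -/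
inductive ChainSum {X : Type*} (v : Pf X → X → ℕ+) : Pf X → ℕ+ → Prop
  | single {F G : Pf X} {f : X} (hFG : F.1 ⊂ G.1) (hf : f ∈ G.1) : ChainSum v F (v G f)
  | cons {F G : Pf X} {f : X} {y : ℕ+} (hFG : F.1 ⊂ G.1) (hf : f ∈ G.1)
      (hy : ChainSum v G y) : ChainSum v F (v G f + y)

theorem ChainSum.mono {X : Type*} {v : Pf X → X → ℕ+} {F F' : Pf X} {y : ℕ+}
    (h : ChainSum v F' y) (hF : F.1 ⊆ F'.1) : ChainSum v F y := by
  cases h with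
  | single hFG hf => exact .single (hF.trans_ssubset hFG) hf
  | cons hFG hf hy => exact .cons (hF.trans_ssubset hFG) hf hy

/-- Take `G` to be the top set of a chain giving `x`: any chain above it can be appended. -/
theorem ChainSum.exists_add {X : Type*} {v : Pf X → X → ℕ+} {F : Pf X} {x : ℕ+}
    (h : ChainSum v F x) : ∃ G, ∀ y, ChainSum v G y → ChainSum v F (x + y) := by
  induction h with
  | @single F G f hFG hf => exact ⟨G, fun y hy => .cons hFG hf hy⟩
  | cons hFG hf _ ih =>
    obtain ⟨G', hG'⟩ := ih
    exact ⟨G', fun y hy => by rw [add_assoc]; exact .cons hFG hf (hG' y hy)⟩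

theorem exists_ssuperset {X : Type*} [Infinite X] (F : Pf X) : ∃ G : Pf X, F.1 ⊂ G.1 := by
  classical
  obtain ⟨x, hx⟩ := Infinite.exists_notMem_finset F.1
  exact ⟨⟨insert x F.1, Finset.insert_nonempty _ _⟩, Finset.ssubset_insert hx⟩

theorem exists_ssuperset_above {X : Type*} [Infinite X] (F K : Pf X) :
    ∃ G : Pf X, F.1 ⊂ G.1 ∧ K.1 ⊆ G.1 := by
  classical
  obtain ⟨G, hG⟩ := exists_ssuperset (⟨F.1 ∪ K.1, F.2.mono Finset.subset_union_left⟩ : Pf X)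
  exact ⟨G, Finset.subset_union_left.trans_ssubset hG, Finset.subset_union_right.trans hG.subset⟩

/-- An infinite chain together with a choice of an element in each of its sets. -/
def IsSelection {X : Type*} (G : ℕ+ → Pf X) (f : ℕ+ → X) : Prop :=
  (∀ i, (G i).1 ⊂ (G (i + 1)).1) ∧ ∀ i, f i ∈ (G i).1

theorem exists_isSelection (X : Type*) [Infinite X] :
    ∃ (G : ℕ+ → Pf X) (f : ℕ+ → X), IsSelection G f := by
  choose e he using exists_ssuperset (X := X)
  obtain ⟨x⟩ := (inferInstance : Nonempty X)
  let G : ℕ+ → Pf X := fun i => e^[i] ⟨{x}, by simp⟩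
  refine ⟨G, fun i => (G i).2.choose, fun i => ?_, fun i => (G i).2.choose_spec⟩
  simp only [G, PNat.add_coe, PNat.one_coe, Function.iterate_succ_apply']
  exact he _

theorem IsSelection.modify {X : Type*} [Infinite X] {G : ℕ+ → Pf X} {f : ℕ+ → X}
    (h : IsSelection G f) (N : ℕ+) {K : Pf X} (hK : (G N).1 ⊂ K.1) {g : X} (hg : g ∈ K.1) :
    ∃ (G' : ℕ+ → Pf X) (f' : ℕ+ → X), IsSelection G' f' ∧
      (∀ i ≤ N, G' i = G i ∧ f' i = f i) ∧ G' (N + 1) = K ∧ f' (N + 1) = g := by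
  choose e he using exists_ssuperset (X := X)
  let G' : ℕ+ → Pf X := fun i => if i ≤ N then G i else e^[(i : ℕ) - (N + 1)] K
  have hlast : G' (N + 1) = K := by
    simp [G', (PNat.lt_add_right N 1).not_ge]
  refine ⟨G', fun i => if i ≤ N then f i else if i = N + 1 then g else (G' i).2.choose,
    ⟨fun i => ?_, fun i => ?_⟩, fun i hi => by simp [G', hi], hlast,
    by simp [(PNat.lt_add_right N 1).not_ge]⟩
  · rcases lt_trichotomy i N with hi | rfl | hi
    · simp only [G', hi.le, PNat.add_one_le_iff.2 hi, if_true]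
      exact h.1 i
    · rw [hlast]
      simpa [G'] using hK
    · have h₁ : ¬ i + 1 ≤ N := (hi.trans (PNat.lt_add_right i 1)).not_ge
      have h₂ : ((i + 1 : ℕ+) : ℕ) - (N + 1) = (i - (N + 1)) + 1 := by
        have : (N : ℕ) < i := hi
        rw [PNat.add_coe, PNat.one_coe]
        omega
      simp only [G', hi.not_ge, h₁, if_false, h₂, Function.iterate_succ_apply']
      exact he _
  · by_cases hi : i ≤ N
    · simpa [G', hi] using h.2 i
    · by_cases hi' : i = N + 1
      · subst hi'
        simpa [hi, hlast] using hg
      · simpa [hi, hi'] using (G' i).2.choose_spec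

/-- The finite chain is spliced in just after position `N`; since nothing up to `N` changes, sums
already formed there survive. -/
theorem ChainSum.exists_selection {X : Type*} [Infinite X] {v : Pf X → X → ℕ+} {F : Pf X}
    {y : ℕ+} (hy : ChainSum v F y) {G : ℕ+ → Pf X} {f : ℕ+ → X} (h : IsSelection G f) {N : ℕ+}
    (hF : G N = F) :
    ∃ (G' : ℕ+ → Pf X) (f' : ℕ+ → X) (N' : ℕ+) (β : Pf ℕ+), IsSelection G' f' ∧
      (∀ i ≤ N, G' i = G i ∧ f' i = f i) ∧ N ≤ N' ∧ (∀ i ∈ β.1, N < i ∧ i ≤ N') ∧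
      y = posSum β fun i => v (G' i) (f' i) := by
  classical
  induction hy generalizing G f N with
  | @single F K g hFK hg =>
    subst hF
    obtain ⟨G', f', h', heq, hG', hf'⟩ := h.modify N hFK hg
    refine ⟨G', f', N + 1, ⟨{N + 1}, by simp⟩, h', heq, (PNat.lt_add_right N 1).le, ?_, ?_⟩
    · simp
    · rw [posSum_singleton, hG', hf']
  | @cons F K g y hFK hg _ ih =>
    subst hF
    obtain ⟨G', f', h', heq, hG', hf'⟩ := h.modify N hFK hg
    obtain ⟨G'', f'', N', β, h'', heq', hN, hβ, hy⟩ := ih h' hG'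
    have hlt := PNat.lt_add_right N 1
    refine ⟨G'', f'', N', ⟨insert (N + 1) β.1, by simp⟩, h'', fun i hi => ?_, hlt.le.trans hN,
      fun i hi => ?_, ?_⟩
    · rw [(heq' i (hi.trans hlt.le)).1, (heq' i (hi.trans hlt.le)).2]
      exact heq i hi
    · rcases Finset.mem_insert.1 hi with rfl | hi
      · exact ⟨hlt, hN⟩
      · exact ⟨hlt.trans (hβ i hi).1, (hβ i hi).2⟩
    · rw [posSum_insert (fun hi => (hβ _ hi).1.false) _ β.2, ← hy, (heq' _ le_rfl).1,
        (heq' _ le_rfl).2, hG', hf']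

theorem isJSet_chainSum (α : Pf (ℕ+ → ℕ+) → ℕ+) (H : Pf (ℕ+ → ℕ+) → Pf ℕ+)
    (F : Pf (ℕ+ → ℕ+)) :
    IsJSet {y | ChainSum (fun G f => α G + posSum (H G) f) F y} := by
  intro K
  obtain ⟨G, hFG, hKG⟩ := exists_ssuperset_above F K
  exact ⟨α G, H G, fun f hf =>
    ChainSum.single (v := fun G f => α G + posSum (H G) f) hFG (hKG hf)⟩

theorem exists_idempotent_chainSum (α : Pf (ℕ+ → ℕ+) → ℕ+) (H : Pf (ℕ+ → ℕ+) → Pf ℕ+) :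
    ∃ p ∈ JUltrafilters, p + p = p ∧
      ∀ F, {y | ChainSum (fun G f => α G + posSum (H G) f) F y} ∈ p := by
  classical
  have : Nonempty (Pf (ℕ+ → ℕ+)) := ⟨⟨{fun _ => 1}, by simp⟩⟩
  refine exists_idempotent_mem_JUltrafilters _ (fun F G => ?_) (isJSet_chainSum α H)
    fun F x hx => hx.exists_add
  exact ⟨⟨F.1 ∪ G.1, F.2.mono Finset.subset_union_left⟩,
    fun y hy => hy.mono Finset.subset_union_left, fun y hy => hy.mono Finset.subset_union_right⟩

theorem mem_tensor_of_chainSum {X : Type*} [Infinite X] {m : ℕ} (v : Fin m → Pf X → X → ℕ+)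
    {p : Fin m → Ultrafilter ℕ+} (hp : ∀ j F, {y | ChainSum (v j) F y} ∈ p j)
    {A : Set (Fin m → ℕ+)}
    (hA : ∀ G f, IsSelection G f → ∀ β : Fin m → Pf ℕ+,
      (∀ j k, j < k → Precedes (β j) (β k)) →
        (fun j => posSum (β j) fun i => v j (G i) (f i)) ∈ A) :
    A ∈ tensor m p := by
  rw [mem_tensor_iff_exists]
  -- Level `k` of the tree: tuples realised on blocks ending by `N`. Any chain sum above `G N` then
  -- gives a successor.
  refine ⟨fun k => {x | ∃ (G : ℕ+ → Pf X) (f : ℕ+ → X) (N : ℕ+) (β : ℕ → Pf ℕ+),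
    IsSelection G f ∧ (∀ j < k, ∀ i ∈ (β j).1, i ≤ N) ∧
    (∀ j l, j < l → l < k → Precedes (β j) (β l)) ∧
    ∀ (j : Fin k) (hj : (j : ℕ) < m), x j = posSum (β j) fun i => v ⟨j, hj⟩ (G i) (f i)},
    ?_, ?_, ?_⟩
  · obtain ⟨G, f, h⟩ := exists_isSelection X
    exact ⟨G, f, 1, fun _ => ⟨{1}, by simp⟩, h, by simp, by simp, fun j => j.elim0⟩
  · rintro k x ⟨G, f, N, β, h, hN, hβ, hx⟩
    refine Filter.mem_of_superset (hp k (G N)) fun y hy => ?_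
    obtain ⟨G', f', N', γ, h', heq, hNN', hγ, hy⟩ := ChainSum.exists_selection hy h rfl
    have hu : Function.update β k γ k = γ := Function.update_self _ _ _
    have hu' : ∀ j : ℕ, j < k → Function.update β k γ j = β j := fun j hj =>
      Function.update_of_ne hj.ne _ _
    refine ⟨G', f', N', Function.update β k γ, h', fun j hj i hi => ?_, fun j l hjl hl => ?_,
      fun j => ?_⟩
    · rcases (Nat.lt_succ_iff.1 hj).eq_or_lt with rfl | hj
      · rw [hu] at hi
        exact (hγ i hi).2
      · rw [hu' j hj] at hi
        exact (hN j hj i hi).trans hNN'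
    · rcases (Nat.lt_succ_iff.1 hl).eq_or_lt with rfl | hl
      · rw [hu, hu' j hjl]
        exact precedes_of_forall_lt fun i hi t ht => (hN j hjl i hi).trans_lt (hγ t ht).1
      · rw [hu' j (hjl.trans hl), hu' l hl]
        exact hβ j l hjl hl
    · refine Fin.lastCases ?_ (fun j => ?_) j
      · intro _
        simp only [Fin.snoc_last, Fin.val_last]
        rw [hu]
        exact hy
      · intro hj
        simp only [Fin.snoc_castSucc, Fin.val_castSucc]
        rw [hu' j j.2, hx j hj]
        refine posSum_congr fun i hi => ?_
        rw [(heq i (hN j j.2 i hi)).1, (heq i (hN j j.2 i hi)).2]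
  · rintro x ⟨G, f, N, β, h, -, hβ, hx⟩
    convert hA G f h (fun j => β j) fun j k hjk => hβ j k hjk k.2 using 1
    funext j
    exact hx j j.2
theorem corollary1p19 (m : ℕ) (hm : 1 ≤ m) (A : Set (Fin m → ℕ+)) :
    (∃ (α : Fin m → Pf (ℕ+ → ℕ+) → ℕ+) (H : Fin m → Pf (ℕ+ → ℕ+) → Pf ℕ+),
      (∀ (j : Fin m) (F G : Pf (ℕ+ → ℕ+)), F.1 ⊂ G.1 → Precedes (H j F) (H j G)) ∧
      (∀ G : ℕ+ → Pf (ℕ+ → ℕ+), (∀ i, (G i).1 ⊂ (G (i + 1)).1) →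
        ∀ β : Fin m → Pf ℕ+, (∀ j k : Fin m, j < k → Precedes (β j) (β k)) →
          ∀ f : ℕ+ → ℕ+ → ℕ+, (∀ i, f i ∈ (G i).1) →
            (fun j : Fin m =>
              posSum (β j) fun i => α j (G i) + posSum (H j (G i)) (f i)) ∈ A)) ↔
    ∃ p : Fin m → Ultrafilter ℕ+,
      (∀ j, p j ∈ JUltrafilters ∧ p j + p j = p j) ∧ A ∈ tensor m p := by
  constructor
  · rintro ⟨α, H, -, hA⟩
    choose p hp hpp hC using fun j => exists_idempotent_chainSum (α j) (H j)
    exact ⟨p, fun j => ⟨hp j, hpp j⟩, mem_tensor_of_chainSum _ hC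
      fun G f h β hβ => hA G h.1 β hβ f h.2⟩
  · rintro ⟨p, hp, hA⟩
    exact exists_chain_functions hp hA
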